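/- Let $\mathcal A,\mathcal B,\mathcal E$ be finite alphabets and let $(A_i,B_i,E_i)_{i\ge1}$ be i.i.d. with joint law $p_{A,B,E}$ on $\mathcal A\times\mathcal B\times\mathcal E$. Alice observes $A^N$ (and possibly also $E^N$) and sends a message $J$ over a noiseless link to Bob, who has side information $B^N$; an eavesdropper Eve sees $J$ and has $E^N$. All logarithms are to base $2$. Say that a pair $(R,\Delta)\in\mathbb R^2$ is achievable *without side information at Alice* if for every $\epsilon>0$ there are a block length $N\ge1$, an integer $M\le 2^{NR}$, an encoder $f:\mathcal A^N\to\{1,\dots,M\}$ and a decoder $g:\{1,\dots,M\}\times\mathcal B^N\to\mathcal A^N$ such that, with $J=f(A^N)$, $$H(A^N\mid J,E^N)\ \ge\ N\Delta\qquad\text{and}\qquad \Pr\big(g(J,B^N)\neq A^N\big)<\epsilon .$$ Say that $(R,\Delta)$ is achievable *with $E^N$ at Alice* if the same holds with encoders $f:\mathcal A^N\times\mathcal E^N\to\{1,\dots,M\}$ and $J=f(A^N,E^N)$. In each case the rate-equivocation region, $\mathcal R$ respectively $\mathcal R_E$, is the closure in $\mathbb R^2$ of the set of achievable pairs. Suppose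 that Eve's observation is a physically degraded version of Bob's, i.e. $A-B-E$ is a Markov chain. Then providing $E^N$ to Alice does not improve the equivocation rate: $I(A;B|E)=I(A;B)-I(A;E)$ and $$\mathcal R_E=\mathcal R=\{(R,\Delta):\ R\ge H(A|B),\ \Delta\le I(A;B)-I(A;E)\} =\{(R,\Delta):\ R\ge H(A|B),\ \Delta\le I(A;B|E)\}.$$ Moreover, for every rate $R>H(A|B)$, the supremum of the $\Delta$ such that $(R,\Delta)$ is achievable without side information at Alice is $I(A;B)-I(A;E)$, and the supremum of the $\Delta$ such that $(R,\Delta)$ is achievable with $E^N$ at Alice is $I(A;B|E)$; these two values are equal. -/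

import Mathlib

namespace SecureCompression

noncomputable section

/-! Information measures (in bits) of functions on a finite sample space `Ω` with
probability mass function `q : Ω → ℝ`. -/

section Information

variable {Ω S T V : Type*} [Fintype Ω]

open Classical in
/-- The probability of an event. -/
def prob (q : Ω → ℝ) (P : Ω → Prop) : ℝ := ∑ ω, if P ω then q ω else 0

/-- The law (probability mass function) of the random variable `X`. -/
def law (q : Ω → ℝ) (X : Ω → S) (s : S) : ℝ := prob q fun ω => X ω = s

/-- `X - Y - Z` is a Markov chain: `X` and `Z` are conditionally independent given `Y`, i.e.
`P(x, y, z) P(y) = P(x, y) P(y, z)` for all `x, y, z`. -/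
def IsMarkovChain (q : Ω → ℝ) (X : Ω → S) (Y : Ω → T) (Z : Ω → V) : Prop :=
  ∀ x y z, law q (fun ω => (X ω, Y ω, Z ω)) (x, y, z) * law q Y y =
    law q (fun ω => (X ω, Y ω)) (x, y) * law q (fun ω => (Y ω, Z ω)) (y, z)

variable [Fintype S] [Fintype T] [Fintype V]

/-- Shannon entropy `H(X) = - ∑ₛ P(X = s) log₂ P(X = s)`. -/
def entropy (q : Ω → ℝ) (X : Ω → S) : ℝ :=
  (∑ s, Real.negMulLog (law q X s)) / Real.log 2

/-- Conditional entropy `H(X | Y) = ∑ₜ P(Y = t) H(X | Y = t)`. Values `t` of probability zero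
contribute zero. -/
def condEntropy (q : Ω → ℝ) (X : Ω → S) (Y : Ω → T) : ℝ :=
  ∑ t, law q Y t *
    ((∑ s, Real.negMulLog (law q (fun ω => (X ω, Y ω)) (s, t) / law q Y t)) / Real.log 2)

/-- Mutual information `I(X; Y) = H(X) - H(X | Y)`. -/
def mutualInfo (q : Ω → ℝ) (X : Ω → S) (Y : Ω → T) : ℝ :=
  entropy q X - condEntropy q X Y

/-- Conditional mutual information `I(X; Y | Z) = H(X | Z) - H(X | Y, Z)`. -/
def condMutualInfo (q : Ω → ℝ) (X : Ω → S) (Y : Ω → T) (Z : Ω → V) : ℝ :=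
  condEntropy q X Z - condEntropy q X fun ω => (Y ω, Z ω)

end Information

/-! The source: one letter is a triple in `𝓐 × 𝓑 × 𝓔` (Alice, Bob, Eve). -/

section Source

variable {𝓐 𝓑 𝓔 : Type*}

/-- Alice's source letter. -/
def letterA : 𝓐 × 𝓑 × 𝓔 → 𝓐 := fun x => x.1

/-- Bob's side information letter. -/
def letterB : 𝓐 × 𝓑 × 𝓔 → 𝓑 := fun x => x.2.1

/-- Eve's side information letter. -/
def letterE : 𝓐 × 𝓑 × 𝓔 → 𝓔 := fun x => x.2.2

/-- The joint probability mass function of `N` independent triples with law `p`. -/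
def iid (p : 𝓐 × 𝓑 × 𝓔 → ℝ) (N : ℕ) (x : Fin N → 𝓐 × 𝓑 × 𝓔) : ℝ := ∏ i, p (x i)

/-- The sequence `A^N`. -/
def seqA (N : ℕ) (x : Fin N → 𝓐 × 𝓑 × 𝓔) : Fin N → 𝓐 := fun i => letterA (x i)

/-- The sequence `B^N`. -/
def seqB (N : ℕ) (x : Fin N → 𝓐 × 𝓑 × 𝓔) : Fin N → 𝓑 := fun i => letterB (x i)

/-- The sequence `E^N`. -/
def seqE (N : ℕ) (x : Fin N → 𝓐 × 𝓑 × 𝓔) : Fin N → 𝓔 := fun i => letterE (x i)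

variable [Fintype 𝓐] [Fintype 𝓑] [Fintype 𝓔]

/-- Eve's equivocation `H(A^N | J, E^N)` (not normalised by `N`), where `J` is the transmitted
message. -/
def equivocation (p : 𝓐 × 𝓑 × 𝓔 → ℝ) {N M : ℕ}
    (J : (Fin N → 𝓐 × 𝓑 × 𝓔) → Fin M) : ℝ :=
  condEntropy (iid p N) (seqA N) fun x => (J x, seqE N x)

/-- Bob's error probability `P(g(J, B^N) ≠ A^N)`, where `J` is the transmitted message. -/
def errorProb (p : 𝓐 × 𝓑 × 𝓔 → ℝ) {N M : ℕ}
    (J : (Fin N → 𝓐 × 𝓑 × 𝓔) → Fin M) (g : Fin M → (Fin N → 𝓑) → Fin N → 𝓐) : ℝ :=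
  prob (iid p N) fun x => g (J x) (seqB N x) ≠ seqA N x

/-- `(R, Δ)` is achievable when Alice observes `A^N` only: for every `δ > 0` there is a code of
some block length `N ≥ 1` with at most `2 ^ (N R)` messages, encoder `f : 𝓐^N → [M]` and decoder
`g : [M] × 𝓑^N → 𝓐^N`, with `H(A^N | f(A^N), E^N) ≥ N Δ` and error probability below `δ`. -/
def Achievable (p : 𝓐 × 𝓑 × 𝓔 → ℝ) (R Δ : ℝ) : Prop :=
  ∀ δ : ℝ, 0 < δ → ∃ N M : ℕ, 1 ≤ N ∧ (M : ℝ) ≤ (2 : ℝ) ^ ((N : ℝ) * R) ∧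
    ∃ (f : (Fin N → 𝓐) → Fin M) (g : Fin M → (Fin N → 𝓑) → Fin N → 𝓐),
      (N : ℝ) * Δ ≤ equivocation p (fun x => f (seqA N x)) ∧
      errorProb p (fun x => f (seqA N x)) g < δ

/-- `(R, Δ)` is achievable when Alice observes both `A^N` and `E^N`: the same, with encoders
`f : 𝓐^N × 𝓔^N → [M]`. -/
def AchievableWithEve (p : 𝓐 × 𝓑 × 𝓔 → ℝ) (R Δ : ℝ) : Prop :=
  ∀ δ : ℝ, 0 < δ → ∃ N M : ℕ, 1 ≤ N ∧ (M : ℝ) ≤ (2 : ℝ) ^ ((N : ℝ) * R) ∧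
    ∃ (f : (Fin N → 𝓐) → (Fin N → 𝓔) → Fin M) (g : Fin M → (Fin N → 𝓑) → Fin N → 𝓐),
      (N : ℝ) * Δ ≤ equivocation p (fun x => f (seqA N x) (seqE N x)) ∧
      errorProb p (fun x => f (seqA N x) (seqE N x)) g < δ

/-- The rate-equivocation region without side information at Alice: the closure of the set of
achievable pairs. -/
def region (p : 𝓐 × 𝓑 × 𝓔 → ℝ) : Set (ℝ × ℝ) :=
  closure {r | Achievable p r.1 r.2}

/-- The rate-equivocation region when Eve's observation is provided to Alice: the closure of the
set of achievable pairs. -/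
def regionWithEve (p : 𝓐 × 𝓑 × 𝓔 → ℝ) : Set (ℝ × ℝ) :=
  closure {r | AchievableWithEve p r.1 r.2}

end Source

end

end SecureCompression

/-! Both directions rest on one-shot entropy inequalities applied to i.i.d. blocks, on which the
entropies involved equal `N` times their single-letter values. Direct part: a Slepian–Wolf code of
rate `R'` just above `H(A|B)` leaks at most `H(J) ≤ N R'` bits, so `H(A^N|J,E^N) ≥ H(A^N|E^N) - H(J)
≥ N (H(A|E) - R')`. Hence every `Δ < H(A|E) - H(A|B)` is achievable, even though Alice ignores `E^N`
(`exists_slepianWolf_code`, `achievable_of_lt`). Converse: for any encoder, even one that sees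
`E^N`, `H(A^N|J,E^N) ≤ I(A^N;B^N|E^N) + H(A^N|J,B^N)`, and Fano makes the last term `o(N)`. Hence `Δ
≤ I(A;B|E)` (`condEntropy_pair_le_add`, `AchievableWithEve.bounds`). The chain `A - B - E` gives
`H(A|B,E) = H(A|B)`, so the two bounds meet and both regions are squeezed to the same quadrant. -/

namespace SecureCompression

/-! ### One-shot entropy inequalities -/

section Information

variable {Ω S T V : Type*} [Fintype Ω]

lemma prob_nonneg {q : Ω → ℝ} (hq : ∀ ω, 0 ≤ q ω) (P : Ω → Prop) : 0 ≤ prob q P := by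
  unfold prob
  refine Finset.sum_nonneg fun ω _ => ?_
  split_ifs
  exacts [hq ω, le_rfl]

/-- The implication is required only at points of positive mass, where no logarithm of a probability
takes its default value at zero. -/
lemma prob_mono {q : Ω → ℝ} (hq : ∀ ω, 0 ≤ q ω) {P Q : Ω → Prop} (h : ∀ ω, 0 < q ω → P ω → Q ω) :
    prob q P ≤ prob q Q := by
  unfold prob
  refine Finset.sum_le_sum fun ω _ => ?_
  rcases (hq ω).eq_or_lt with h0 | h0
  · simp [← h0]
  by_cases hP : P ω
  · simp [hP, h ω h0 hP]
  · rw [if_neg hP]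
    split_ifs
    exacts [hq ω, le_rfl]

lemma law_nonneg {q : Ω → ℝ} (hq : ∀ ω, 0 ≤ q ω) (X : Ω → S) (s : S) : 0 ≤ law q X s :=
  prob_nonneg hq _

lemma le_law {q : Ω → ℝ} (hq : ∀ ω, 0 ≤ q ω) (X : Ω → S) (ω : Ω) : q ω ≤ law q X (X ω) := by
  classical
  unfold law prob
  have := Finset.single_le_sum (f := fun ω' => if X ω' = X ω then q ω' else 0)
    (fun i _ => by
      split_ifs
      exacts [hq i, le_rfl]) (Finset.mem_univ ω)
  simpa using this

lemma law_pos {q : Ω → ℝ} (hq : ∀ ω, 0 ≤ q ω) (X : Ω → S) {ω : Ω} (h : 0 < q ω) :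
    0 < law q X (X ω) :=
  h.trans_le (le_law hq X ω)

lemma law_le_law_comp {q : Ω → ℝ} (hq : ∀ ω, 0 ≤ q ω) (X : Ω → S) (φ : S → T) (s : S) :
    law q X s ≤ law q (fun ω => φ (X ω)) (φ s) :=
  prob_mono hq fun _ _ h => congrArg φ h

lemma sum_law_mul [Fintype S] (q : Ω → ℝ) (X : Ω → S) (φ : S → ℝ) :
    ∑ s, law q X s * φ s = ∑ ω, q ω * φ (X ω) := by
  classical
  unfold law prob
  simp_rw [Finset.sum_mul]
  rw [Finset.sum_comm]
  refine Finset.sum_congr rfl fun ω _ => ?_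
  simp [ite_mul]

lemma sum_law [Fintype S] (q : Ω → ℝ) (X : Ω → S) : ∑ s, law q X s = ∑ ω, q ω := by
  simpa using sum_law_mul q X fun _ => 1

lemma sum_law_fst [Fintype S] (q : Ω → ℝ) (X : Ω → S) (Y : Ω → T) (t : T) :
    ∑ s, law q (fun ω => (X ω, Y ω)) (s, t) = law q Y t := by
  classical
  unfold law prob
  rw [Finset.sum_comm]
  refine Finset.sum_congr rfl fun ω _ => ?_
  by_cases h : Y ω = t <;> simp [h]

lemma sum_law_snd [Fintype T] (q : Ω → ℝ) (X : Ω → S) (Y : Ω → T) (s : S) :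
    ∑ t, law q (fun ω => (X ω, Y ω)) (s, t) = law q X s := by
  classical
  unfold law prob
  rw [Finset.sum_comm]
  refine Finset.sum_congr rfl fun ω _ => ?_
  by_cases h : X ω = s <;> simp [h]

lemma entropy_eq_sum [Fintype S] (q : Ω → ℝ) (X : Ω → S) :
    entropy q X = -∑ ω, q ω * Real.logb 2 (law q X (X ω)) := by
  rw [← sum_law_mul q X fun s => Real.logb 2 (law q X s), entropy, Finset.sum_div,
    ← Finset.sum_neg_distrib]
  refine Finset.sum_congr rfl fun s _ => ?_
  rw [Real.negMulLog, Real.logb]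
  ring

/-- The chain rule `H(X | Y) = H(X, Y) - H(Y)`. -/
lemma condEntropy_eq_sub [Fintype S] [Fintype T] {q : Ω → ℝ} (hq : ∀ ω, 0 ≤ q ω)
    (X : Ω → S) (Y : Ω → T) :
    condEntropy q X Y = entropy q (fun ω => (X ω, Y ω)) - entropy q Y := by
  unfold condEntropy entropy
  rw [Fintype.sum_prod_type_right, Finset.sum_div, Finset.sum_div, ← Finset.sum_sub_distrib]
  refine Finset.sum_congr rfl fun t _ => ?_
  rw [← sub_div, mul_div_assoc']
  congr 1
  have hsum := sum_law_fst q X Y t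
  by_cases ht : law q Y t = 0
  · rw [ht] at hsum ⊢
    have h0 := (Finset.sum_eq_zero_iff_of_nonneg fun s _ => law_nonneg hq _ _).1 hsum
    simp [fun s => h0 s (Finset.mem_univ s)]
  · have key : ∀ s, law q Y t *
        Real.negMulLog (law q (fun ω => (X ω, Y ω)) (s, t) / law q Y t) =
        Real.negMulLog (law q (fun ω => (X ω, Y ω)) (s, t)) +
          law q (fun ω => (X ω, Y ω)) (s, t) * Real.log (law q Y t) := by
      intro s
      by_cases hs : law q (fun ω => (X ω, Y ω)) (s, t) = 0
      · simp [hs]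
      · rw [Real.negMulLog, Real.negMulLog, Real.log_div hs ht]
        field_simp
        ring
    rw [Finset.mul_sum, Finset.sum_congr rfl fun s _ => key s, Finset.sum_add_distrib,
      ← Finset.sum_mul, hsum, Real.negMulLog]
    ring

/-- Gibbs' inequality. -/
lemma entropy_le_of_sum_le [Fintype S] {q : Ω → ℝ} (hq : ∀ ω, 0 ≤ q ω) (X : Ω → S) {r : S → ℝ}
    (hr : ∀ s, 0 ≤ r s) (hr' : ∀ ω, 0 < q ω → 0 < r (X ω)) (hsum : ∑ s, r s ≤ ∑ ω, q ω) :
    entropy q X ≤ -∑ ω, q ω * Real.logb 2 (r (X ω)) := by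
  have hlog : 0 < Real.log 2 := Real.log_pos one_lt_two
  have key : ∑ ω, q ω * (Real.log (r (X ω)) - Real.log (law q X (X ω))) ≤ 0 := by
    calc ∑ ω, q ω * (Real.log (r (X ω)) - Real.log (law q X (X ω)))
        ≤ ∑ ω, q ω * (r (X ω) / law q X (X ω) - 1) := by
          refine Finset.sum_le_sum fun ω _ => ?_
          rcases (hq ω).eq_or_lt with h | h
          · simp [← h]
          · refine mul_le_mul_of_nonneg_left ?_ h.le
            rw [← Real.log_div (hr' ω h).ne' (law_pos hq X h).ne']
            exact Real.log_le_sub_one_of_pos (div_pos (hr' ω h) (law_pos hq X h))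
      _ = ∑ s, law q X s * (r s / law q X s) - ∑ ω, q ω := by
          rw [sum_law_mul q X fun s => r s / law q X s, ← Finset.sum_sub_distrib]
          exact Finset.sum_congr rfl fun ω _ => by ring
      -- Only an inequality: where the law vanishes, the quotient is `0` by convention and the mass
      -- `r s` is lost.
      _ ≤ ∑ s, r s - ∑ ω, q ω := by
          refine sub_le_sub_right (Finset.sum_le_sum fun s _ => ?_) _
          by_cases h : law q X s = 0
          · simpa [h] using hr s
          · rw [mul_div_cancel₀ _ h]
      _ ≤ 0 := by linarith
  rw [entropy_eq_sum, neg_le_neg_iff, ← sub_nonpos, ← Finset.sum_sub_distrib]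
  have : ∑ ω, (q ω * Real.logb 2 (r (X ω)) - q ω * Real.logb 2 (law q X (X ω))) =
      (∑ ω, q ω * (Real.log (r (X ω)) - Real.log (law q X (X ω)))) / Real.log 2 := by
    rw [Finset.sum_div]
    refine Finset.sum_congr rfl fun ω _ => ?_
    rw [Real.logb, Real.logb]
    ring
  rw [this]
  exact div_nonpos_of_nonpos_of_nonneg key hlog.le

lemma entropy_comp_le [Fintype S] [Fintype T] {q : Ω → ℝ} (hq : ∀ ω, 0 ≤ q ω) (X : Ω → S)
    (φ : S → T) : entropy q (fun ω => φ (X ω)) ≤ entropy q X := by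
  rw [entropy_eq_sum, entropy_eq_sum, neg_le_neg_iff]
  refine Finset.sum_le_sum fun ω _ => ?_
  rcases (hq ω).eq_or_lt with h | h
  · simp [← h]
  · exact mul_le_mul_of_nonneg_left (Real.logb_le_logb_of_le one_lt_two (law_pos hq X h)
      (law_le_law_comp hq X φ _)) h.le

/-- Used to reorder tuples and drop redundant components. The maps need to be mutually inverse only
along the values taken. -/
lemma entropy_congr [Fintype S] [Fintype T] {q : Ω → ℝ} (hq : ∀ ω, 0 ≤ q ω) {X : Ω → S}
    {Y : Ω → T} (φ : S → T) (ψ : T → S) (h : ∀ ω, φ (X ω) = Y ω) (h' : ∀ ω, ψ (Y ω) = X ω) :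
    entropy q X = entropy q Y := by
  apply le_antisymm
  · simpa only [h'] using entropy_comp_le hq Y ψ
  · simpa only [h] using entropy_comp_le hq X φ

lemma entropy_le_logb_card [Fintype S] {q : Ω → ℝ} (hq : q ∈ stdSimplex ℝ Ω) (X : Ω → S) :
    entropy q X ≤ Real.logb 2 (Fintype.card S) := by
  rcases isEmpty_or_nonempty S with hS | hS
  · simp [entropy]
  have hc : (0 : ℝ) < Fintype.card S := by exact_mod_cast Fintype.card_pos
  refine (entropy_le_of_sum_le hq.1 X (r := fun _ => (Fintype.card S : ℝ)⁻¹)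
    (fun _ => (inv_pos.2 hc).le) (fun _ _ => inv_pos.2 hc) ?_).trans ?_
  · simp [hq.2]
  · rw [← Finset.sum_mul, hq.2, Real.logb_inv]
    simp

/-- Submodularity of entropy: conditioning does not increase entropy. -/
lemma condEntropy_pair_le [Fintype S] [Fintype T] [Fintype V] {q : Ω → ℝ} (hq : ∀ ω, 0 ≤ q ω)
    (X : Ω → S) (Y : Ω → T) (Z : Ω → V) :
    condEntropy q X (fun ω => (Y ω, Z ω)) ≤ condEntropy q X Z := by
  rw [condEntropy_eq_sub hq, condEntropy_eq_sub hq]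
  -- Gibbs against `P(x,z) P(y,z) / P(z)`, the law under which `X` and `Y` are conditionally
  -- independent given `Z`.
  have key := entropy_le_of_sum_le hq (fun ω => (X ω, Y ω, Z ω))
    (r := fun s => law q (fun ω => (X ω, Z ω)) (s.1, s.2.2) *
      law q (fun ω => (Y ω, Z ω)) s.2 / law q Z s.2.2)
    (fun s => div_nonneg (mul_nonneg (law_nonneg hq _ _) (law_nonneg hq _ _)) (law_nonneg hq _ _))
    (fun ω h => div_pos (mul_pos (law_pos hq (fun ω => (X ω, Z ω)) h)
      (law_pos hq (fun ω => (Y ω, Z ω)) h)) (law_pos hq Z h)) ?_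
  · have hsplit : ∑ ω, q ω * Real.logb 2 (law q (fun ω => (X ω, Z ω)) (X ω, Z ω) *
        law q (fun ω => (Y ω, Z ω)) (Y ω, Z ω) / law q Z (Z ω)) =
        ∑ ω, q ω * Real.logb 2 (law q (fun ω => (X ω, Z ω)) (X ω, Z ω)) +
        ∑ ω, q ω * Real.logb 2 (law q (fun ω => (Y ω, Z ω)) (Y ω, Z ω)) -
        ∑ ω, q ω * Real.logb 2 (law q Z (Z ω)) := by
      rw [← Finset.sum_add_distrib, ← Finset.sum_sub_distrib]
      refine Finset.sum_congr rfl fun ω _ => ?_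
      rcases (hq ω).eq_or_lt with h | h
      · simp [← h]
      · rw [Real.logb_div (mul_pos (law_pos hq (fun ω => (X ω, Z ω)) h)
          (law_pos hq (fun ω => (Y ω, Z ω)) h)).ne' (law_pos hq Z h).ne',
          Real.logb_mul (law_pos hq (fun ω => (X ω, Z ω)) h).ne'
          (law_pos hq (fun ω => (Y ω, Z ω)) h).ne']
        ring
    dsimp only at key
    rw [hsplit] at key
    have e1 := entropy_eq_sum q fun ω => (X ω, Z ω)
    have e2 := entropy_eq_sum q fun ω => (Y ω, Z ω)
    have e3 := entropy_eq_sum q Z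
    linarith
  · rw [Fintype.sum_prod_type_right, ← sum_law q fun ω => (Y ω, Z ω)]
    refine Finset.sum_le_sum fun s _ => ?_
    dsimp only
    rw [← Finset.sum_div, ← Finset.sum_mul, sum_law_fst q X Z]
    by_cases h : law q Z s.2 = 0
    · simpa [h] using law_nonneg hq _ _
    · rw [mul_div_cancel_left₀ _ h]

lemma condEntropy_le_entropy [Fintype S] [Fintype T] {q : Ω → ℝ} (hq : q ∈ stdSimplex ℝ Ω)
    (X : Ω → S) (Y : Ω → T) : condEntropy q X Y ≤ entropy q X := by
  have h := condEntropy_pair_le hq.1 X Y fun _ => ()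
  have h1 : condEntropy q X (fun ω => (Y ω, ())) = condEntropy q X Y := by
    rw [condEntropy_eq_sub hq.1, condEntropy_eq_sub hq.1,
      entropy_congr hq.1 (X := fun ω => (X ω, Y ω, ())) (Y := fun ω => (X ω, Y ω))
        (fun s => (s.1, s.2.1)) (fun s => (s.1, s.2, ())) (fun _ => rfl) fun _ => rfl,
      entropy_congr hq.1 (X := fun ω => (Y ω, ())) (Y := Y)
        (fun s => s.1) (fun s => (s, ())) (fun _ => rfl) fun _ => rfl]
  have h2 : condEntropy q X (fun _ => ()) = entropy q X := by
    have h0 : entropy q (fun _ => ()) = 0 := by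
      simp [entropy, law, prob, hq.2]
    rw [condEntropy_eq_sub hq.1, h0, sub_zero]
    exact entropy_congr hq.1 (fun s => s.1) (fun s => (s, ())) (fun _ => rfl) fun _ => rfl
  linarith

lemma condEntropy_nonneg [Fintype S] [Fintype T] {q : Ω → ℝ} (hq : ∀ ω, 0 ≤ q ω)
    (X : Ω → S) (Y : Ω → T) : 0 ≤ condEntropy q X Y := by
  rw [condEntropy_eq_sub hq, sub_nonneg]
  exact entropy_comp_le hq (fun ω => (X ω, Y ω)) Prod.snd

/-- A form of Fano's inequality with a free parameter `θ`. -/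
lemma condEntropy_le_of_estimator [Fintype S] [Fintype T] {q : Ω → ℝ} (hq : q ∈ stdSimplex ℝ Ω)
    (X : Ω → S) (Y : Ω → T) (g : T → S) {θ : ℝ} (h0 : 0 < θ) (h1 : θ < 1) :
    condEntropy q X Y ≤ -Real.logb 2 (1 - θ) +
      prob q (fun ω => g (Y ω) ≠ X ω) * Real.logb 2 (Fintype.card S / θ) := by
  classical
  have hΩ : Nonempty Ω := by
    by_contra h
    rw [not_nonempty_iff] at h
    simpa using hq.2
  have hS : Nonempty S := hΩ.map X
  have hc : (0 : ℝ) < Fintype.card S := by exact_mod_cast Fintype.card_pos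
  -- Test channel for Gibbs: guess `g t` with weight `1 - θ`, otherwise uniform. A correct guess
  -- costs at most `-log (1 - θ)`, a wrong one exactly `log (|S| / θ)`.
  set w : S × T → ℝ := fun s => (if s.1 = g s.2 then 1 - θ else 0) + θ / Fintype.card S with hw
  have hwpos : ∀ s, 0 < w s := fun s => by
    have : 0 < θ / Fintype.card S := by positivity
    simp only [hw]
    split_ifs <;> linarith
  have key := entropy_le_of_sum_le hq.1 (fun ω => (X ω, Y ω))
    (r := fun s => w s * law q Y s.2)
    (fun s => mul_nonneg (hwpos s).le (law_nonneg hq.1 _ _))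
    (fun ω h => mul_pos (hwpos _) (law_pos hq.1 Y h)) ?_
  · rw [condEntropy_eq_sub hq.1]
    have hsplit : ∑ ω, q ω * Real.logb 2 (w (X ω, Y ω) * law q Y (Y ω)) =
        ∑ ω, q ω * Real.logb 2 (w (X ω, Y ω)) - entropy q Y := by
      rw [entropy_eq_sum, sub_neg_eq_add, ← Finset.sum_add_distrib]
      refine Finset.sum_congr rfl fun ω _ => ?_
      rcases (hq.1 ω).eq_or_lt with h | h
      · simp [← h]
      · rw [Real.logb_mul (hwpos _).ne' (law_pos hq.1 Y h).ne']
        ring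
    have hbound : -∑ ω, q ω * Real.logb 2 (w (X ω, Y ω)) ≤ -Real.logb 2 (1 - θ) +
        prob q (fun ω => g (Y ω) ≠ X ω) * Real.logb 2 (Fintype.card S / θ) := by
      have e1 : -Real.logb 2 (1 - θ) = ∑ ω, q ω * -Real.logb 2 (1 - θ) := by
        rw [← Finset.sum_mul, hq.2, one_mul]
      rw [e1, prob, Finset.sum_mul, ← Finset.sum_neg_distrib, ← Finset.sum_add_distrib]
      refine Finset.sum_le_sum fun ω _ => ?_
      have hθ : Real.logb 2 (1 - θ) ≤ 0 :=
        Real.logb_nonpos one_lt_two (by linarith) (by linarith)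
      by_cases h : g (Y ω) = X ω
      · have : Real.logb 2 (1 - θ) ≤ Real.logb 2 (w (X ω, Y ω)) := by
          refine Real.logb_le_logb_of_le one_lt_two (by linarith) ?_
          have : 0 < θ / Fintype.card S := by positivity
          simp only [hw, h, if_true]
          linarith
        have := mul_le_mul_of_nonneg_left this (hq.1 ω)
        simp only [h, ne_eq, not_true_eq_false, if_false]
        linarith
      · have e : w (X ω, Y ω) = (Fintype.card S / θ)⁻¹ := by
          simp only [hw, if_neg (Ne.symm h), zero_add, inv_div]
        have := mul_nonneg (hq.1 ω) (neg_nonneg.2 hθ)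
        rw [e, Real.logb_inv, if_pos h]
        linarith
    rw [hsplit] at key
    linarith
  · rw [Fintype.sum_prod_type_right, ← sum_law q Y]
    refine le_of_eq (Finset.sum_congr rfl fun t _ => ?_)
    dsimp only [hw]
    rw [← Finset.sum_mul, Finset.sum_add_distrib]
    simp only [Finset.sum_ite_eq', Finset.mem_univ, if_true, Finset.sum_const, Finset.card_univ,
      nsmul_eq_mul]
    rw [mul_div_cancel₀ _ hc.ne']
    ring

/-- For a Markov chain `X - Y - Z`, `H(X | Y, Z) = H(X | Y)`. -/
lemma IsMarkovChain.condEntropy_eq [Fintype S] [Fintype T] [Fintype V] {q : Ω → ℝ}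
    (hq : ∀ ω, 0 ≤ q ω) {X : Ω → S} {Y : Ω → T} {Z : Ω → V} (h : IsMarkovChain q X Y Z) :
    condEntropy q X (fun ω => (Y ω, Z ω)) = condEntropy q X Y := by
  unfold condEntropy
  rw [Fintype.sum_prod_type]
  refine Finset.sum_congr rfl fun y _ => ?_
  rw [← sum_law_snd q Y Z y, Finset.sum_mul]
  refine Finset.sum_congr rfl fun z _ => ?_
  -- Terms of zero weight vanish; in the others the Markov identity is equality of the two
  -- conditional laws.
  by_cases hyz : law q (fun ω => (Y ω, Z ω)) (y, z) = 0
  · rw [hyz, zero_mul, zero_mul]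
  have hy : law q Y y ≠ 0 :=
    ((lt_of_le_of_ne (law_nonneg hq _ _) (Ne.symm hyz)).trans_le
      (law_le_law_comp hq (fun ω => (Y ω, Z ω)) Prod.fst (y, z))).ne'
  congr 3 with x
  rw [sum_law_snd, (div_eq_div_iff hyz hy).2 (h x y z)]

end Information

/-! ### Product measures and single-letter formulas -/

section Information

variable {Ω : Type*} [Fintype Ω]

section Product

variable {N : ℕ}

lemma sum_prod_comp (φ : Ω → ℝ) : ∑ x : Fin N → Ω, ∏ i, φ (x i) = (∑ ω, φ ω) ^ N := by
  classical
  have := Finset.prod_univ_sum (fun _ : Fin N => (Finset.univ : Finset Ω)) fun _ ω => φ ω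
  rw [Fintype.piFinset_univ] at this
  rw [← this]
  simp

lemma sum_prod_mul_apply {q : Ω → ℝ} (hq : ∑ ω, q ω = 1) (φ : Ω → ℝ) (j : Fin N) :
    ∑ x : Fin N → Ω, (∏ i, q (x i)) * φ (x j) = ∑ ω, q ω * φ ω := by
  classical
  have := Finset.prod_univ_sum (fun _ : Fin N => (Finset.univ : Finset Ω))
    fun i ω => q ω * if i = j then φ ω else 1
  rw [Fintype.piFinset_univ] at this
  calc ∑ x : Fin N → Ω, (∏ i, q (x i)) * φ (x j)
      = ∑ x : Fin N → Ω, ∏ i, q (x i) * (if i = j then φ (x i) else 1) := by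
        refine Finset.sum_congr rfl fun x _ => ?_
        rw [Finset.prod_mul_distrib]
        simp
    _ = ∏ i : Fin N, ∑ ω, q ω * (if i = j then φ ω else 1) := this.symm
    _ = ∑ ω, q ω * φ ω := by
        rw [Finset.prod_eq_single j]
        · simp
        · intro i _ hi
          simp [hi, hq]
        · simp

end Product

end Information

section Source

variable {𝓐 𝓑 𝓔 S : Type*} [Fintype 𝓐] [Fintype 𝓑] [Fintype 𝓔] {p : 𝓐 × 𝓑 × 𝓔 → ℝ}

lemma iid_mem_stdSimplex (hp : p ∈ stdSimplex ℝ (𝓐 × 𝓑 × 𝓔)) (N : ℕ) :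
    iid p N ∈ stdSimplex ℝ (Fin N → 𝓐 × 𝓑 × 𝓔) := by
  refine ⟨fun x => Finset.prod_nonneg fun i _ => hp.1 _, ?_⟩
  simp only [iid]
  rw [sum_prod_comp, hp.2, one_pow]

lemma law_iid (p : 𝓐 × 𝓑 × 𝓔 → ℝ) (N : ℕ) (X : 𝓐 × 𝓑 × 𝓔 → S) (s : Fin N → S) :
    law (iid p N) (fun x i => X (x i)) s = ∏ i, law p X (s i) := by
  classical
  unfold law prob
  rw [Finset.prod_univ_sum, Fintype.piFinset_univ]
  refine Finset.sum_congr rfl fun x _ => ?_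
  by_cases h : (fun i => X (x i)) = s
  · subst h
    simp [iid]
  · rw [if_neg h]
    obtain ⟨i, hi⟩ := Function.ne_iff.1 h
    exact (Finset.prod_eq_zero (Finset.mem_univ i) (if_neg hi)).symm

lemma entropy_iid [Fintype S] (hp : p ∈ stdSimplex ℝ (𝓐 × 𝓑 × 𝓔)) (N : ℕ)
    (X : 𝓐 × 𝓑 × 𝓔 → S) :
    entropy (iid p N) (fun x i => X (x i)) = N * entropy p X := by
  rw [entropy_eq_sum, entropy_eq_sum, mul_neg, neg_inj]
  have h1 : ∀ x : Fin N → 𝓐 × 𝓑 × 𝓔,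
      iid p N x * Real.logb 2 (law (iid p N) (fun x i => X (x i)) fun i => X (x i)) =
      ∑ i, (∏ k, p (x k)) * Real.logb 2 (law p X (X (x i))) := by
    intro x
    rw [← Finset.mul_sum, law_iid]
    change (∏ k, p (x k)) * _ = _
    -- The logarithm of the product splits only when all factors are nonzero, which positive mass
    -- guarantees.
    by_cases h : ∏ k, p (x k) = 0
    · simp [h]
    · rw [Real.logb_prod]
      intro i _
      exact (law_pos hp.1 X (lt_of_le_of_ne (hp.1 _)
        (Ne.symm (Finset.prod_ne_zero_iff.1 h i (Finset.mem_univ i))))).ne'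
  rw [Finset.sum_congr rfl fun x _ => h1 x, Finset.sum_comm,
    Finset.sum_congr rfl fun i _ => sum_prod_mul_apply hp.2
      (fun ω => Real.logb 2 (law p X (X ω))) i]
  simp

lemma entropy_iid_pair [Fintype S] {T : Type*} [Fintype T] (hp : p ∈ stdSimplex ℝ (𝓐 × 𝓑 × 𝓔))
    (N : ℕ) (X : 𝓐 × 𝓑 × 𝓔 → S) (Y : 𝓐 × 𝓑 × 𝓔 → T) :
    entropy (iid p N) (fun x => ((fun i => X (x i)), (fun i => Y (x i)))) =
      N * entropy p (fun ω => (X ω, Y ω)) := by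
  rw [← entropy_iid hp N]
  exact entropy_congr (iid_mem_stdSimplex hp N).1
    (fun s i => (s.1 i, s.2 i)) (fun s => (fun i => (s i).1, fun i => (s i).2))
    (fun _ => rfl) fun _ => rfl

lemma condEntropy_iid [Fintype S] {T : Type*} [Fintype T] (hp : p ∈ stdSimplex ℝ (𝓐 × 𝓑 × 𝓔))
    (N : ℕ) (X : 𝓐 × 𝓑 × 𝓔 → S) (Y : 𝓐 × 𝓑 × 𝓔 → T) :
    condEntropy (iid p N) (fun x i => X (x i)) (fun x i => Y (x i)) =
      N * condEntropy p X Y := by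
  rw [condEntropy_eq_sub (iid_mem_stdSimplex hp N).1, condEntropy_eq_sub hp.1,
    entropy_iid_pair hp, entropy_iid hp]
  ring

end Source

/-! ### Random binning -/

section Binning

variable {Ω S T : Type*} [Fintype Ω]

/-- Two distinct points are put into the same one of `M` bins by at most a fraction `1 / M` of all
binnings. -/
lemma card_collision_mul_le [Fintype S] [DecidableEq S] {M : ℕ} {a b : S} (hab : a ≠ b) :
    (Finset.univ.filter fun f : S → Fin M => f a = f b).card * M ≤
      Fintype.card (S → Fin M) := by
  have hprod := Finset.card_product (Finset.univ.filter fun f : S → Fin M => f a = f b)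
    (Finset.univ : Finset (Fin M))
  rw [Finset.card_univ, Fintype.card_fin] at hprod
  rw [← hprod, ← Finset.card_univ]
  -- Rebinning `a` arbitrarily is injective on colliding binnings, since the lost value `f a` can be
  -- read off from `f b`.
  refine Finset.card_le_card_of_injOn (fun z => Function.update z.1 a z.2)
    (fun _ _ => Finset.mem_coe.2 (Finset.mem_univ _)) ?_
  rintro ⟨f, j⟩ hf ⟨f', j'⟩ hf' h
  simp only [Finset.coe_product, Finset.coe_filter, Finset.mem_univ, true_and, Set.mem_prod,
    Set.mem_ofPred_eq, Finset.coe_univ, Set.mem_univ, and_true] at hf hf'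
  have hj : j = j' := by simpa using congrFun h a
  have hne : ∀ c, c ≠ a → f c = f' c := fun c hc => by simpa [hc] using congrFun h c
  refine Prod.ext (funext fun c => ?_) hj
  by_cases hc : c = a
  · subst hc
    exact hf.trans ((hne b hab.symm).trans hf'.symm)
  · exact hne c hc

/-- One-shot source coding with side information at the decoder, by random binning. -/
lemma exists_binning [Fintype S] [Nonempty S] {q : Ω → ℝ} (hq : q ∈ stdSimplex ℝ Ω)
    (X : Ω → S) (Y : Ω → T) (rel : S → T → Prop) {L : ℝ}
    (hL : ∀ y, ({x | rel x y}.ncard : ℝ) ≤ L) {M : ℕ} (hM : 0 < M) :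
    ∃ (f : S → Fin M) (g : Fin M → T → S),
      prob q (fun ω => g (f (X ω)) (Y ω) ≠ X ω) ≤ prob q (fun ω => ¬ rel (X ω) (Y ω)) + L / M := by
  classical
  have hM' : (0 : ℝ) < M := by exact_mod_cast hM
  have : Nonempty (Fin M) := ⟨⟨0, hM⟩⟩
  -- The decoder picks any element of the announced bin compatible with `y`.
  set g : (S → Fin M) → Fin M → T → S := fun f j y =>
    if h : ∃ x, f x = j ∧ rel x y then h.choose else Classical.arbitrary S with hg
  have hgspec : ∀ (f : S → Fin M) (x : S) (y : T), rel x y →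
      f (g f (f x) y) = f x ∧ rel (g f (f x) y) y := by
    intro f x y hxy
    have h : ∃ x', f x' = f x ∧ rel x' y := ⟨x, rfl, hxy⟩
    simp only [hg, dif_pos h]
    exact h.choose_spec
  set F : ℝ := ((Fintype.card (S → Fin M) : ℕ) : ℝ) with hF
  have hF0 : 0 < F := by
    rw [hF]
    exact_mod_cast Fintype.card_pos
  -- Summed over all binnings at fixed `ω`: if `rel` holds, an error needs one of at most `L`
  -- competitors to share the bin, each doing so for at most `F / M` binnings.
  have hpt : ∀ ω, ∑ f : S → Fin M, (if g f (f (X ω)) (Y ω) ≠ X ω then q ω else 0) ≤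
      F * (if ¬ rel (X ω) (Y ω) then q ω else 0) + q ω * (F * (L / M)) := by
    intro ω
    have hL0 : 0 ≤ L := (Nat.cast_nonneg _).trans (hL (Y ω))
    by_cases hr : rel (X ω) (Y ω)
    · rw [if_neg (not_not.2 hr), mul_zero, zero_add]
      have h1 : ∀ f : S → Fin M, (if g f (f (X ω)) (Y ω) ≠ X ω then q ω else 0) ≤
          ∑ x' ∈ Finset.univ.filter fun x' => rel x' (Y ω) ∧ x' ≠ X ω,
            if f x' = f (X ω) then q ω else 0 := by
        intro f
        have hnn : ∀ x' ∈ Finset.univ.filter fun x' => rel x' (Y ω) ∧ x' ≠ X ω,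
            0 ≤ if f x' = f (X ω) then q ω else 0 := fun x' _ => by
          split_ifs
          exacts [hq.1 ω, le_rfl]
        split_ifs with he
        · obtain ⟨e1, e2⟩ := hgspec f _ _ hr
          have := Finset.single_le_sum hnn
            (Finset.mem_filter.2 ⟨Finset.mem_univ (g f (f (X ω)) (Y ω)), e2, he⟩)
          rwa [if_pos e1] at this
        · exact Finset.sum_nonneg hnn
      refine (Finset.sum_le_sum fun f _ => h1 f).trans ?_
      rw [Finset.sum_comm]
      have h2 : ∀ x' ∈ Finset.univ.filter fun x' => rel x' (Y ω) ∧ x' ≠ X ω,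
          ∑ f : S → Fin M, (if f x' = f (X ω) then q ω else 0) ≤ q ω * (F / M) := by
        intro x' hx'
        rw [← Finset.sum_filter, Finset.sum_const, nsmul_eq_mul, mul_comm]
        refine mul_le_mul_of_nonneg_left ?_ (hq.1 ω)
        rw [le_div_iff₀ hM', hF]
        exact_mod_cast card_collision_mul_le (Finset.mem_filter.1 hx').2.2
      refine (Finset.sum_le_sum h2).trans ?_
      rw [Finset.sum_const, nsmul_eq_mul]
      have h3 : ((Finset.univ.filter fun x' => rel x' (Y ω) ∧ x' ≠ X ω).card : ℝ) ≤ L := by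
        refine le_trans ?_ (hL (Y ω))
        have hsub : (↑(Finset.univ.filter fun x' => rel x' (Y ω) ∧ x' ≠ X ω) : Set S) ⊆
            {x | rel x (Y ω)} := fun x hx => (Finset.mem_filter.1 (Finset.mem_coe.1 hx)).2.1
        rw [← Set.ncard_coe_finset]
        exact Nat.cast_le.2 (Set.ncard_le_ncard hsub (Set.toFinite _))
      calc _ ≤ L * (q ω * (F / M)) :=
            mul_le_mul_of_nonneg_right h3 (mul_nonneg (hq.1 ω) (by positivity))
        _ = q ω * (F * (L / M)) := by ring
    · have h1 : ∑ f : S → Fin M, (if g f (f (X ω)) (Y ω) ≠ X ω then q ω else 0) ≤ F * q ω := by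
        rw [hF, ← nsmul_eq_mul, ← Finset.card_univ, ← Finset.sum_const]
        refine Finset.sum_le_sum fun f _ => ?_
        split_ifs
        exacts [le_rfl, hq.1 ω]
      rw [if_pos hr]
      exact h1.trans (le_add_of_nonneg_right (mul_nonneg (hq.1 ω) (by positivity)))
  have hsum : ∑ f : S → Fin M, prob q (fun ω => g f (f (X ω)) (Y ω) ≠ X ω) ≤
      ∑ _f : S → Fin M, (prob q (fun ω => ¬ rel (X ω) (Y ω)) + L / M) := by
    rw [Finset.sum_const, nsmul_eq_mul, Finset.card_univ]
    have hcongr : ∀ (P : Ω → Prop) [DecidablePred P],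
        prob q P = ∑ ω, if P ω then q ω else 0 := by
      intro P _
      refine Finset.sum_congr rfl fun ω _ => ?_
      by_cases h : P ω <;> simp [h]
    rw [Finset.sum_congr rfl fun f _ => hcongr fun ω => g f (f (X ω)) (Y ω) ≠ X ω,
      hcongr fun ω => ¬ rel (X ω) (Y ω)]
    rw [Finset.sum_comm]
    refine (Finset.sum_le_sum fun ω _ => hpt ω).trans_eq ?_
    rw [Finset.sum_add_distrib, ← Finset.sum_mul, hq.2, ← Finset.mul_sum, one_mul, ← mul_add]
  -- Some binning does no worse than the average.
  obtain ⟨f, -, hf⟩ := Finset.exists_le_of_sum_le Finset.univ_nonempty hsum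
  exact ⟨f, g f, hf⟩

end Binning

/-! ### Law of large numbers -/

section LargeDeviations

variable {𝓐 𝓑 𝓔 : Type*} [Fintype 𝓐] [Fintype 𝓑] [Fintype 𝓔] {p : 𝓐 × 𝓑 × 𝓔 → ℝ}

/-- The weak law of large numbers, in the form of Chernoff's bound. -/
lemma tendsto_prob_iid_sum_ge (hp : p ∈ stdSimplex ℝ (𝓐 × 𝓑 × 𝓔)) (φ : 𝓐 × 𝓑 × 𝓔 → ℝ) {c : ℝ}
    (hc : ∑ ω, p ω * φ ω < c) :
    Filter.Tendsto (fun N : ℕ => prob (iid p N) fun x => N * c ≤ ∑ i, φ (x i))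
      Filter.atTop (nhds 0) := by
  classical
  set m : ℝ → ℝ := fun s => ∑ ω, p ω * Real.exp (s * (φ ω - c)) with hm
  have hm0 : m 0 = 1 := by simp [hm, hp.2]
  have hder : HasDerivAt m (∑ ω, p ω * (φ ω - c)) 0 := by
    have : ∀ ω ∈ Finset.univ, HasDerivAt (fun s => p ω * Real.exp (s * (φ ω - c)))
        (p ω * (φ ω - c)) 0 := by
      intro ω _
      have h := (((hasDerivAt_id (0 : ℝ)).mul_const (φ ω - c)).exp).const_mul (p ω)
      simpa using h
    simpa [hm] using HasDerivAt.fun_sum this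
  have hneg : ∑ ω, p ω * (φ ω - c) < 0 := by
    simp only [mul_sub, Finset.sum_sub_distrib, ← Finset.sum_mul, hp.2]
    linarith
  -- The moment generating function `m` of `φ - c` equals `1` at `0` with negative slope, so it dips
  -- below `1` at some `s > 0`; the probability is then at most `m s ^ N`.
  obtain ⟨s, hs, hms⟩ : ∃ s : ℝ, 0 < s ∧ m s < 1 := by
    have h := hder.hasDerivWithinAt (s := Set.Ioi 0)
    have h2 := (hasDerivWithinAt_iff_tendsto_slope' (by simp)).1 h
    have h3 := h2.eventually_lt_const hneg
    obtain ⟨s, hs1, hs2⟩ := (h3.and self_mem_nhdsWithin).exists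
    refine ⟨s, hs2, ?_⟩
    have hs0 : 0 < s := hs2
    rw [slope_def_field, sub_zero, div_lt_iff₀ hs0, hm0] at hs1
    linarith
  have hm_nonneg : 0 ≤ m s := Finset.sum_nonneg fun ω _ => mul_nonneg (hp.1 ω) (Real.exp_pos _).le
  refine tendsto_of_tendsto_of_tendsto_of_le_of_le tendsto_const_nhds
    (tendsto_pow_atTop_nhds_zero_of_lt_one hm_nonneg hms)
    (fun N => prob_nonneg (iid_mem_stdSimplex hp N).1 _) fun N => ?_
  rw [← sum_prod_comp, prob]
  refine Finset.sum_le_sum fun x _ => ?_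
  have hx := (iid_mem_stdSimplex hp N).1 x
  rw [Finset.prod_mul_distrib, ← Real.exp_sum, ← Finset.mul_sum]
  change _ ≤ iid p N x * _
  split_ifs with h
  · refine le_mul_of_one_le_right hx (Real.one_le_exp (mul_nonneg hs.le ?_))
    simp only [Finset.sum_sub_distrib, Finset.sum_const, Finset.card_univ, Fintype.card_fin,
      nsmul_eq_mul]
    linarith
  · exact mul_nonneg hx (Real.exp_pos _).le

end LargeDeviations

/-! ### Entropy inequalities for a transmitted message -/

section Information

variable {Ω S T V U : Type*} [Fintype Ω] [Fintype S] [Fintype T] [Fintype V] [Fintype U]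

lemma entropy_pair_le_add {q : Ω → ℝ} (hq : q ∈ stdSimplex ℝ Ω) (X : Ω → S) (Y : Ω → T) :
    entropy q (fun ω => (X ω, Y ω)) ≤ entropy q X + entropy q Y := by
  have h := condEntropy_le_entropy hq X Y
  rw [condEntropy_eq_sub hq.1] at h
  linarith

lemma condEntropy_sub_entropy_le {q : Ω → ℝ} (hq : q ∈ stdSimplex ℝ Ω)
    (X : Ω → S) (J : Ω → U) (Z : Ω → V) :
    condEntropy q X Z - entropy q J ≤ condEntropy q X (fun ω => (J ω, Z ω)) := by
  have h1 := entropy_comp_le hq.1 (fun ω => (X ω, J ω, Z ω)) fun s => (s.1, s.2.2)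
  have h2 := entropy_pair_le_add hq J Z
  rw [condEntropy_eq_sub hq.1, condEntropy_eq_sub hq.1]
  dsimp only at h1
  linarith

/-- Heart of the converse. With `J = φ(X,Z)`, `H(X|J,Z) = I(X;Y|J,Z) + H(X|J,Y,Z)`. Since `J` is
determined by `(X,Z)`, `I(X;Y|J,Z) = H(Y|J,Z) - H(Y|X,Z) ≤ I(X;Y|Z)`; dropping `Z` from the last
conditioning only increases it. -/
lemma condEntropy_pair_le_add {q : Ω → ℝ} (hq : ∀ ω, 0 ≤ q ω)
    (X : Ω → S) (Y : Ω → T) (Z : Ω → V) (φ : S → V → U) :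
    condEntropy q X (fun ω => (φ (X ω) (Z ω), Z ω)) ≤
      condMutualInfo q X Y Z + condEntropy q X (fun ω => (φ (X ω) (Z ω), Y ω)) := by
  have h1 : entropy q (fun ω => (X ω, φ (X ω) (Z ω), Z ω)) = entropy q (fun ω => (X ω, Z ω)) :=
    entropy_congr hq (fun s => (s.1, s.2.2)) (fun s => (s.1, φ s.1 s.2, s.2))
      (fun _ => rfl) fun _ => rfl
  have h2 : entropy q (fun ω => (X ω, (φ (X ω) (Z ω), Y ω), Z ω)) =
      entropy q (fun ω => (X ω, Y ω, Z ω)) :=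
    entropy_congr hq (fun s => (s.1, s.2.1.2, s.2.2))
      (fun s => (s.1, (φ s.1 s.2.2, s.2.1), s.2.2)) (fun _ => rfl) fun _ => rfl
  have h3 : entropy q (fun ω => ((φ (X ω) (Z ω), Y ω), Z ω)) =
      entropy q (fun ω => (Y ω, φ (X ω) (Z ω), Z ω)) :=
    entropy_congr hq (fun s => (s.1.2, s.1.1, s.2)) (fun s => ((s.2.1, s.1), s.2.2))
      (fun _ => rfl) fun _ => rfl
  have h4 := condEntropy_pair_le hq X (fun ω => Z ω) (fun ω => (φ (X ω) (Z ω), Y ω))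
  have h5 := condEntropy_pair_le hq Y (fun ω => φ (X ω) (Z ω)) Z
  have h6 : condEntropy q X (fun ω => (Z ω, φ (X ω) (Z ω), Y ω)) =
      condEntropy q X (fun ω => ((φ (X ω) (Z ω), Y ω), Z ω)) := by
    rw [condEntropy_eq_sub hq, condEntropy_eq_sub hq]
    congr 1
    · exact entropy_congr hq (fun s => (s.1, s.2.2, s.2.1)) (fun s => (s.1, s.2.2, s.2.1))
        (fun _ => rfl) fun _ => rfl
    · exact entropy_congr hq (fun s => (s.2, s.1)) (fun s => (s.2, s.1))
        (fun _ => rfl) fun _ => rfl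
  rw [h6, condEntropy_eq_sub hq X fun ω => ((φ (X ω) (Z ω), Y ω), Z ω), h2, h3] at h4
  rw [condEntropy_eq_sub hq, condEntropy_eq_sub hq] at h5
  rw [condMutualInfo, condEntropy_eq_sub hq X fun ω => (φ (X ω) (Z ω), Z ω), h1,
    condEntropy_eq_sub hq X Z, condEntropy_eq_sub hq X fun ω => (Y ω, Z ω)]
  linarith

lemma logb_card_le {q : Ω → ℝ} (hq : q ∈ stdSimplex ℝ Ω) {M : ℕ} (J : Ω → Fin M) {c : ℝ}
    (hM : (M : ℝ) ≤ (2 : ℝ) ^ c) : Real.logb 2 M ≤ c := by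
  have hΩ : Nonempty Ω := by
    by_contra h
    rw [not_nonempty_iff] at h
    simpa using hq.2
  -- A value of `J` excludes `M = 0`, where the default `log 0 = 0` could exceed a negative `c`.
  have hM0 : (0 : ℝ) < M := by exact_mod_cast (J hΩ.some).pos
  exact (Real.logb_le_iff_le_rpow one_lt_two hM0).2 hM

end Information

/-! ### Coding theorem and converse -/

section Source

variable {𝓐 𝓑 𝓔 : Type*} [Fintype 𝓐] [Fintype 𝓑] [Fintype 𝓔] {p : 𝓐 × 𝓑 × 𝓔 → ℝ}

/-- The Slepian–Wolf theorem: rates above `H(A | B)` allow reliable compression. -/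
lemma exists_slepianWolf_code (hp : p ∈ stdSimplex ℝ (𝓐 × 𝓑 × 𝓔)) {R δ : ℝ}
    (hR : condEntropy p letterA letterB < R) (hδ : 0 < δ) :
    ∃ N M : ℕ, 1 ≤ N ∧ (M : ℝ) ≤ (2 : ℝ) ^ ((N : ℝ) * R) ∧
      ∃ (f : (Fin N → 𝓐) → Fin M) (g : Fin M → (Fin N → 𝓑) → Fin N → 𝓐),
        errorProb p (fun x => f (seqA N x)) g < δ := by
  classical
  have : Nonempty 𝓐 := by
    by_contra h
    rw [not_nonempty_iff] at h
    simpa using hp.2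
  obtain ⟨c, hc1, hc2⟩ := exists_between hR
  have hR0 : 0 ≤ R := (condEntropy_nonneg hp.1 _ _).trans hR.le
  set w : 𝓐 → 𝓑 → ℝ := fun a b =>
    law p (fun x => (letterA x, letterB x)) (a, b) / law p letterB b with hw
  have hw0 : ∀ a b, 0 ≤ w a b := fun a b => div_nonneg (law_nonneg hp.1 _ _) (law_nonneg hp.1 _ _)
  have hwpos : ∀ x, 0 < p x → 0 < w (letterA x) (letterB x) := fun x hx =>
    div_pos (law_pos hp.1 (fun x => (letterA x, letterB x)) hx) (law_pos hp.1 letterB hx)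
  have hwsum : ∀ b, ∑ a, w a b ≤ 1 := fun b => by
    simp only [hw]
    rw [← Finset.sum_div, sum_law_fst p letterA letterB]
    exact div_self_le_one _
  have hmean : ∑ x, p x * -Real.logb 2 (w (letterA x) (letterB x)) =
      condEntropy p letterA letterB := by
    rw [condEntropy_eq_sub hp.1, entropy_eq_sum, entropy_eq_sum, neg_sub_neg,
      ← Finset.sum_sub_distrib]
    refine Finset.sum_congr rfl fun x _ => ?_
    rcases (hp.1 x).eq_or_lt with h | h
    · simp [← h]
    · rw [Real.logb_div (law_pos hp.1 (fun x => (letterA x, letterB x)) h).ne'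
        (law_pos hp.1 letterB h).ne']
      ring
  have htail := tendsto_prob_iid_sum_ge hp
    (fun x => -Real.logb 2 (w (letterA x) (letterB x))) (hmean.trans_lt hc1)
  have hgeom : Filter.Tendsto (fun N : ℕ => 2 * ((2 : ℝ) ^ (c - R)) ^ N) Filter.atTop (nhds 0) := by
    have h := (tendsto_pow_atTop_nhds_zero_of_lt_one (Real.rpow_pos_of_pos two_pos (c - R)).le
      (Real.rpow_lt_one_of_one_lt_of_neg one_lt_two (sub_neg.2 hc2))).const_mul 2
    simpa using h
  obtain ⟨N, ⟨h1, h2⟩, hN⟩ := (((htail.eventually_lt_const (half_pos hδ)).and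
    (hgeom.eventually_lt_const (half_pos hδ))).and (Filter.eventually_ge_atTop 1)).exists
  -- One-sided typicality, `P(a|b) > 2 ^ (-N c)`: as conditional probabilities sum to at most `1`,
  -- fewer than about `2 ^ (N c)` sequences qualify for each `b`.
  set rel : (Fin N → 𝓐) → (Fin N → 𝓑) → Prop := fun a b =>
    (2 : ℝ) ^ (-(N * c)) < ∏ i, w (a i) (b i) with hrel
  have hcard : ∀ b, ({a | rel a b}.ncard : ℝ) ≤ (2 : ℝ) ^ (N * c) := by
    intro b
    have hset : {a | rel a b} = ↑(Finset.univ.filter fun a => rel a b) := by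
      ext a
      simp
    rw [hset, Set.ncard_coe_finset]
    have e1 : ((Finset.univ.filter fun a => rel a b).card : ℝ) * (2 : ℝ) ^ (-(N * c)) ≤ 1 := by
      rw [← nsmul_eq_mul, ← Finset.sum_const]
      calc ∑ _a ∈ Finset.univ.filter fun a => rel a b, (2 : ℝ) ^ (-(N * c))
          ≤ ∑ a ∈ Finset.univ.filter fun a => rel a b, ∏ i, w (a i) (b i) :=
            Finset.sum_le_sum fun a ha => (Finset.mem_filter.1 ha).2.le
        _ ≤ ∑ a : Fin N → 𝓐, ∏ i, w (a i) (b i) :=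
            Finset.sum_le_sum_of_subset_of_nonneg (Finset.filter_subset _ _)
              fun a _ _ => Finset.prod_nonneg fun i _ => hw0 _ _
        _ = ∏ i, ∑ a, w a (b i) := by
            rw [Finset.prod_univ_sum, Fintype.piFinset_univ]
        _ ≤ 1 := Finset.prod_le_one (fun i _ => Finset.sum_nonneg fun a _ => hw0 _ _)
            fun i _ => hwsum _
    have e2 : (2 : ℝ) ^ (-(N * c)) * (2 : ℝ) ^ (N * c) = 1 := by
      rw [← Real.rpow_add two_pos, neg_add_cancel, Real.rpow_zero]
    have e3 := mul_le_mul_of_nonneg_right e1 (Real.rpow_pos_of_pos two_pos (N * c)).le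
    rwa [mul_assoc, e2, mul_one, one_mul] at e3
  have hpow1 : (1 : ℝ) ≤ (2 : ℝ) ^ ((N : ℝ) * R) :=
    Real.one_le_rpow one_le_two (mul_nonneg (Nat.cast_nonneg _) hR0)
  have hM : 0 < ⌊(2 : ℝ) ^ ((N : ℝ) * R)⌋₊ := Nat.floor_pos.2 hpow1
  obtain ⟨f, g, hfg⟩ := exists_binning (iid_mem_stdSimplex hp N) (seqA N) (seqB N) rel hcard hM
  refine ⟨N, _, hN, Nat.floor_le (by linarith), f, g, hfg.trans_lt ?_⟩
  have hA : prob (iid p N) (fun x => ¬ rel (seqA N x) (seqB N x)) < δ / 2 := by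
    refine lt_of_le_of_lt (prob_mono (iid_mem_stdSimplex hp N).1 fun x hx hn => ?_) h1
    have hx' : ∀ i, 0 < w (letterA (x i)) (letterB (x i)) := fun i =>
      hwpos _ (lt_of_le_of_ne (hp.1 _)
        (Ne.symm (Finset.prod_ne_zero_iff.1 hx.ne' i (Finset.mem_univ i))))
    have hle : ∏ i, w (letterA (x i)) (letterB (x i)) ≤ (2 : ℝ) ^ (-(N * c)) := not_lt.1 hn
    have := Real.logb_le_logb_of_le one_lt_two (Finset.prod_pos fun i _ => hx' i) hle
    rw [Real.logb_rpow two_pos (by norm_num), Real.logb_prod _ _ (fun i _ => (hx' i).ne')] at this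
    rw [Finset.sum_neg_distrib]
    linarith
  have hB : (2 : ℝ) ^ (N * c) / (⌊(2 : ℝ) ^ ((N : ℝ) * R)⌋₊ : ℝ) ≤
      2 * ((2 : ℝ) ^ (c - R)) ^ N := by
    have hM' : (1 : ℝ) ≤ (⌊(2 : ℝ) ^ ((N : ℝ) * R)⌋₊ : ℝ) := by exact_mod_cast hM
    -- Rounding down costs at most a factor `2`, because the floor is at least `1`.
    have hlt := Nat.lt_floor_add_one ((2 : ℝ) ^ ((N : ℝ) * R))
    rw [div_le_iff₀ (by linarith)]
    have e : ((2 : ℝ) ^ (c - R)) ^ N * (2 : ℝ) ^ ((N : ℝ) * R) = (2 : ℝ) ^ (N * c) := by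
      rw [← Real.rpow_natCast, ← Real.rpow_mul two_pos.le, ← Real.rpow_add two_pos]
      congr 1
      ring
    rw [← e, mul_comm 2, mul_assoc]
    exact mul_le_mul_of_nonneg_left (by linarith) (by positivity)
  linarith

lemma achievable_of_lt (hp : p ∈ stdSimplex ℝ (𝓐 × 𝓑 × 𝓔)) {R Δ : ℝ}
    (hR : condEntropy p letterA letterB < R)
    (hΔ : Δ < condEntropy p letterA letterE - condEntropy p letterA letterB) :
    Achievable p R Δ := by
  intro δ hδ
  -- The code may use less than the allowed rate: staying below `H(A|E) - Δ` caps the leakage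
  -- through `J`.
  have hR' : condEntropy p letterA letterB < min R (condEntropy p letterA letterE - Δ) :=
    lt_min hR (by linarith)
  obtain ⟨N, M, hN, hM, f, g, hfg⟩ := exists_slepianWolf_code hp hR' hδ
  have hN0 : (0 : ℝ) ≤ N := Nat.cast_nonneg _
  refine ⟨N, M, hN, hM.trans (Real.rpow_le_rpow_of_exponent_le one_le_two
    (mul_le_mul_of_nonneg_left (min_le_left _ _) hN0)), f, g, ?_, hfg⟩
  have h1 := condEntropy_sub_entropy_le (iid_mem_stdSimplex hp N) (seqA N)
    (fun x => f (seqA N x)) (seqE N)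
  have h2 : condEntropy (iid p N) (seqA N) (seqE N) = N * condEntropy p letterA letterE :=
    condEntropy_iid hp N letterA letterE
  have h3 := entropy_le_logb_card (iid_mem_stdSimplex hp N) fun x => f (seqA N x)
  rw [Fintype.card_fin] at h3
  have h4 := logb_card_le (iid_mem_stdSimplex hp N) (fun x => f (seqA N x)) hM
  have h5 := mul_le_mul_of_nonneg_left
    (min_le_right R (condEntropy p letterA letterE - Δ)) hN0
  rw [equivocation]
  linarith

lemma Achievable.achievableWithEve {R Δ : ℝ} (h : Achievable p R Δ) :
    AchievableWithEve p R Δ := by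
  intro δ hδ
  obtain ⟨N, M, hN, hM, f, g, h1, h2⟩ := h δ hδ
  exact ⟨N, M, hN, hM, fun a _ => f a, g, h1, h2⟩

/-- Fano's inequality for block codes: a small error probability forces a small conditional
entropy per letter, uniformly in the block length. -/
lemma exists_forall_condEntropy_le (hp : p ∈ stdSimplex ℝ (𝓐 × 𝓑 × 𝓔)) {η : ℝ} (hη : 0 < η) :
    ∃ δ : ℝ, 0 < δ ∧ ∀ (N M : ℕ) (J : (Fin N → 𝓐 × 𝓑 × 𝓔) → Fin M)
      (g : Fin M → (Fin N → 𝓑) → Fin N → 𝓐), 1 ≤ N → errorProb p J g < δ →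
      condEntropy (iid p N) (seqA N) (fun x => (J x, seqB N x)) ≤ N * η := by
  have hA : Nonempty 𝓐 := by
    by_contra h
    rw [not_nonempty_iff] at h
    simpa using hp.2
  have hcard : (1 : ℝ) ≤ Fintype.card 𝓐 := by exact_mod_cast Fintype.card_pos
  -- Chosen so that `-log (1 - θ) = η / 2`; the error term receives the other half.
  set θ : ℝ := 1 - (2 : ℝ) ^ (-(η / 2)) with hθ
  have hpow : (2 : ℝ) ^ (-(η / 2)) < 1 :=
    Real.rpow_lt_one_of_one_lt_of_neg one_lt_two (by linarith)
  have hpow0 : 0 < (2 : ℝ) ^ (-(η / 2)) := Real.rpow_pos_of_pos two_pos _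
  have h0 : 0 < θ := by linarith
  have h1 : θ < 1 := by linarith
  have hlogθ : Real.logb 2 θ < 0 := Real.logb_neg one_lt_two h0 h1
  have hlogA : 0 ≤ Real.logb 2 (Fintype.card 𝓐) := Real.logb_nonneg one_lt_two hcard
  set K : ℝ := Real.logb 2 (Fintype.card 𝓐) - Real.logb 2 θ with hK
  have hK0 : 0 < K := by linarith
  -- `N ≥ 1` gives `log (|𝓐|^N / θ) ≤ N K`, so this threshold is independent of `N`.
  refine ⟨η / 2 / K, by positivity, fun N M J g hN herr => ?_⟩
  have hN' : (1 : ℝ) ≤ N := by exact_mod_cast hN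
  have hfano := condEntropy_le_of_estimator (iid_mem_stdSimplex hp N) (seqA N)
    (fun x => (J x, seqB N x)) (fun t => g t.1 t.2) h0 h1
  have hlog1 : Real.logb 2 (1 - θ) = -(η / 2) := by
    rw [hθ, sub_sub_cancel, Real.logb_rpow two_pos (by norm_num)]
  have hlog2 : Real.logb 2 ((Fintype.card (Fin N → 𝓐) : ℕ) / θ) ≤ N * K := by
    rw [Fintype.card_fun, Fintype.card_fin, Nat.cast_pow, Real.logb_div (by positivity) h0.ne',
      Real.logb_pow]
    nlinarith
  have herr0 : 0 ≤ errorProb p J g := prob_nonneg (iid_mem_stdSimplex hp N).1 _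
  have hmul : errorProb p J g * Real.logb 2 ((Fintype.card (Fin N → 𝓐) : ℕ) / θ) ≤
      N * (η / 2) :=
    calc _ ≤ errorProb p J g * (N * K) := mul_le_mul_of_nonneg_left hlog2 herr0
      _ ≤ η / 2 / K * (N * K) := mul_le_mul_of_nonneg_right herr.le (by positivity)
      _ = N * (η / 2) := by
        field_simp
  rw [hlog1, neg_neg] at hfano
  change _ ≤ η / 2 + errorProb p J g * _ at hfano
  nlinarith

lemma AchievableWithEve.bounds (hp : p ∈ stdSimplex ℝ (𝓐 × 𝓑 × 𝓔)) {R Δ : ℝ}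
    (h : AchievableWithEve p R Δ) :
    condEntropy p letterA letterB ≤ R ∧ Δ ≤ condMutualInfo p letterA letterB letterE := by
  suffices key : ∀ η : ℝ, 0 < η → condEntropy p letterA letterB ≤ R + η ∧
      Δ ≤ condMutualInfo p letterA letterB letterE + η from
    ⟨le_of_forall_pos_le_add fun η hη => (key η hη).1,
      le_of_forall_pos_le_add fun η hη => (key η hη).2⟩
  intro η hη
  -- The block length is known only after `δ` is fixed, hence the need for a Fano bound uniform in
  -- `N`.
  obtain ⟨δ, hδ, hfano⟩ := exists_forall_condEntropy_le hp hη
  obtain ⟨N, M, hN, hM, f, g, hΔ, herr⟩ := h δ hδ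
  have hN' : (0 : ℝ) < N := by exact_mod_cast hN
  have hq := iid_mem_stdSimplex hp N
  have hF := hfano N M _ g hN herr
  constructor
  · have h1 := condEntropy_sub_entropy_le hq (seqA N) (fun x => f (seqA N x) (seqE N x)) (seqB N)
    have h2 : condEntropy (iid p N) (seqA N) (seqB N) = N * condEntropy p letterA letterB :=
      condEntropy_iid hp N letterA letterB
    have h3 := entropy_le_logb_card hq fun x => f (seqA N x) (seqE N x)
    rw [Fintype.card_fin] at h3
    have h4 := logb_card_le hq (fun x => f (seqA N x) (seqE N x)) hM
    refine le_of_mul_le_mul_left ?_ hN'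
    linarith
  · have h1 := condEntropy_pair_le_add hq.1 (seqA N) (seqB N) (seqE N) f
    have h2 : condMutualInfo (iid p N) (seqA N) (seqB N) (seqE N) =
        N * condMutualInfo p letterA letterB letterE := by
      have e1 : condEntropy (iid p N) (seqA N) (seqE N) = N * condEntropy p letterA letterE :=
        condEntropy_iid hp N letterA letterE
      have e2 : condEntropy (iid p N) (seqA N) (fun x => (seqB N x, seqE N x)) =
          N * condEntropy p letterA (fun x => (letterB x, letterE x)) := by
        rw [← condEntropy_iid hp, condEntropy_eq_sub hq.1, condEntropy_eq_sub hq.1]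
        congr 1
        · exact entropy_congr hq.1 (fun s => (s.1, fun i => (s.2.1 i, s.2.2 i)))
            (fun s => (s.1, fun i => (s.2 i).1, fun i => (s.2 i).2)) (fun _ => rfl) fun _ => rfl
        · exact entropy_congr hq.1 (fun s i => (s.1 i, s.2 i))
            (fun s => (fun i => (s i).1, fun i => (s i).2)) (fun _ => rfl) fun _ => rfl
      rw [condMutualInfo, condMutualInfo, e1, e2]
      ring
    rw [equivocation] at hΔ
    refine le_of_mul_le_mul_left ?_ hN'
    linarith

end Source

/-- Boundary pairs need not be achievable: the open quadrant is already dense in the closed one. -/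
lemma closure_eq_quadrant {s : Set (ℝ × ℝ)} {a b : ℝ} (h1 : ∀ r : ℝ × ℝ, a < r.1 → r.2 < b → r ∈ s)
    (h2 : ∀ r ∈ s, a ≤ r.1 ∧ r.2 ≤ b) : closure s = {r | a ≤ r.1 ∧ r.2 ≤ b} := by
  apply subset_antisymm
  · refine closure_minimal h2 ?_
    exact (isClosed_le continuous_const continuous_fst).inter
      (isClosed_le continuous_snd continuous_const)
  · have hsub : Set.Ioi a ×ˢ Set.Iio b ⊆ s := fun r hr => h1 r hr.1 hr.2
    have := closure_mono hsub
    rw [closure_prod_eq, closure_Ioi, closure_Iio] at this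
    exact this

end SecureCompression

theorem corollary4 {𝓐 𝓑 𝓔 : Type*} [Fintype 𝓐] [Fintype 𝓑] [Fintype 𝓔]
    (p : 𝓐 × 𝓑 × 𝓔 → ℝ) (hp : p ∈ stdSimplex ℝ (𝓐 × 𝓑 × 𝓔))
    (hmarkov : SecureCompression.IsMarkovChain p
      SecureCompression.letterA SecureCompression.letterB SecureCompression.letterE) :
    -- the two single-letter values coincide
    SecureCompression.condMutualInfo p
        SecureCompression.letterA SecureCompression.letterB SecureCompression.letterE =
      SecureCompression.mutualInfo p SecureCompression.letterA SecureCompression.letterB -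
        SecureCompression.mutualInfo p SecureCompression.letterA SecureCompression.letterE ∧
    -- the rate-equivocation region without side information at Alice
    SecureCompression.region p =
      {r : ℝ × ℝ |
        SecureCompression.condEntropy p SecureCompression.letterA SecureCompression.letterB ≤ r.1 ∧
        r.2 ≤
          SecureCompression.mutualInfo p SecureCompression.letterA SecureCompression.letterB -
          SecureCompression.mutualInfo p SecureCompression.letterA SecureCompression.letterE} ∧
    -- providing Eve's observation to Alice leaves the region unchanged
    SecureCompression.regionWithEve p =
      {r : ℝ × ℝ |
        SecureCompression.condEntropy p SecureCompression.letterA SecureCompression.letterB ≤ r.1 ∧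
        r.2 ≤ SecureCompression.condMutualInfo p
          SecureCompression.letterA SecureCompression.letterB SecureCompression.letterE} ∧
    SecureCompression.regionWithEve p = SecureCompression.region p ∧
    -- at each rate above `H(A|B)`, the best equivocation rates with and without `E^N` at Alice
    (∀ R : ℝ,
      SecureCompression.condEntropy p SecureCompression.letterA SecureCompression.letterB < R →
      IsLUB {Δ : ℝ | SecureCompression.Achievable p R Δ}
        (SecureCompression.mutualInfo p SecureCompression.letterA SecureCompression.letterB -
          SecureCompression.mutualInfo p SecureCompression.letterA SecureCompression.letterE) ∧
      IsLUB {Δ : ℝ | SecureCompression.AchievableWithEve p R Δ}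
        (SecureCompression.condMutualInfo p
          SecureCompression.letterA SecureCompression.letterB SecureCompression.letterE)) := by
  have hinfo : SecureCompression.condMutualInfo p SecureCompression.letterA
      SecureCompression.letterB SecureCompression.letterE =
      SecureCompression.mutualInfo p SecureCompression.letterA SecureCompression.letterB -
        SecureCompression.mutualInfo p SecureCompression.letterA SecureCompression.letterE := by
    rw [SecureCompression.condMutualInfo, hmarkov.condEntropy_eq hp.1,
      SecureCompression.mutualInfo, SecureCompression.mutualInfo]
    ring
  have hdirect : ∀ R Δ : ℝ,
      SecureCompression.condEntropy p SecureCompression.letterA SecureCompression.letterB < R →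
      Δ < SecureCompression.condMutualInfo p SecureCompression.letterA
        SecureCompression.letterB SecureCompression.letterE →
      SecureCompression.Achievable p R Δ := by
    intro R Δ hR hΔ
    -- Degradedness turns `I(A;B|E)` into `H(A|E) - H(A|B)`, the value reached by binning.
    rw [SecureCompression.condMutualInfo, hmarkov.condEntropy_eq hp.1] at hΔ
    exact SecureCompression.achievable_of_lt hp hR hΔ
  have hregion := SecureCompression.closure_eq_quadrant
    (s := {r | SecureCompression.Achievable p r.1 r.2}) (fun r => hdirect r.1 r.2)
    fun r hr => (SecureCompression.Achievable.achievableWithEve hr).bounds hp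
  have hregionE := SecureCompression.closure_eq_quadrant
    (s := {r | SecureCompression.AchievableWithEve p r.1 r.2})
    (fun r h1 h2 => (hdirect r.1 r.2 h1 h2).achievableWithEve)
    fun r hr => SecureCompression.AchievableWithEve.bounds hp hr
  rw [← hinfo]
  refine ⟨rfl, hregion, hregionE, hregionE.trans hregion.symm, fun R hR => ⟨?_, ?_⟩⟩
  -- The achievable set lies between the open and closed half-lines, so whether the endpoint is
  -- attained is immaterial.
  · exact isLUB_Iio.of_subset_of_superset isLUB_Iic (fun Δ hΔ => hdirect R Δ hR hΔ)
      fun Δ hΔ => (SecureCompression.Achievable.achievableWithEve hΔ).bounds hp |>.2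
  · exact isLUB_Iio.of_subset_of_superset isLUB_Iic
      (fun Δ hΔ => (hdirect R Δ hR hΔ).achievableWithEve)
      fun Δ hΔ => (SecureCompression.AchievableWithEve.bounds hp hΔ).2
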